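/- For a family $A$ of finite sets let $\Delta(A)=\{a\setminus\{x\} : a\in A,\ x\in a\}$ be its (lower) shadow, $\Delta^0(A)=A$, $\Delta^i(A)=\Delta(\Delta^{i-1}(A))$, and for families $A,B$ let $A\vee B=\{a\cup b : a\in A,\ b\in B\}$. Let $[N]=\{1,\dots,N\}$, let $[p,q]$ be the set of integers from $p$ to $q$, and let $\binom{X}{i}$ be the family of $i$-subsets of $X$. For $k\ge 1$, a non-empty family $T\subseteq\binom{[N]}{k}$ is called extremal (for the Kruskal–Katona theorem) if $$|\Delta(T)|=\binom{a_0}{k-1}+\binom{a_1}{k-2}+\cdots+\binom{a_t}{k-t-1},$$ where $|T|=\binom{a_0}{k}+\binom{a_1}{k-1}+\cdots+\binom{a_t}{k-t}$, with $a_0>a_1>\cdots>a_t\ge k-t\ge 1$, is the $k$-binomial decomposition of $|T|$. Theorem 9. Let $n\ge 0$ and $k\ge 1$. For every non-empty family $S\subseteq\binom{[n]}{k}$ there is a positive integer $r_0=r_0(S)$ such that, for every $r\ge r_0$, the family of $k$-subsets of $[n+r]$ $$S'(r)=\bigcup_{i=0}^{k}\left(\Delta^{i}(S)\vee\binom{[n+1,n+r]}{i}\right)$$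 is extremal and satisfies $\{A\in S'(r) : A\subseteq[n]\}=S$. In particular every non-empty family of $k$-sets is an induced subfamily of an extremal family. -/

import Mathlib

open Finset
open scoped FinsetFamily

/-- `m = C(a₀, k) + C(a₁, k - 1) + ⋯ + C(aₜ, k - t)` is the `k`-binomial decomposition of `m`:
`a₀ > a₁ > ⋯ > aₜ ≥ k - t ≥ 1`. Only the terms `a 0, …, a t` of the sequence `a` matter. -/
structure IsBinomialDecomposition (k m t : ℕ) (a : ℕ → ℕ) : Prop where
  length_le : t + 1 ≤ k
  strictAnti : ∀ i < t, a (i + 1) < a i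
  le_last : k - t ≤ a t
  sum_eq : m = ∑ j ∈ range (t + 1), (a j).choose (k - j)

/-- A family `S` of `k`-subsets of `[N] = {1, …, N}` is extremal for the Kruskal–Katona theorem:
it is non-empty and its (lower) shadow has exactly
`C(a₀, k - 1) + C(a₁, k - 2) + ⋯ + C(aₜ, k - t - 1)` elements, where `(a₀, …, aₜ)` is the
`k`-binomial decomposition of the cardinality of `S`. -/
def IsExtremalFamily (N k : ℕ) (S : Finset (Finset ℕ)) : Prop :=
  S ⊆ powersetCard k (Icc 1 N) ∧ S.Nonempty ∧
    ∃ (t : ℕ) (a : ℕ → ℕ), IsBinomialDecomposition k (#S) t a ∧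
      #(∂ S) = ∑ j ∈ range (t + 1), (a j).choose (k - j - 1)

/-- The family `⋃_{i = 0}^{k} Δⁱ(S) ∨ C([n + 1, n + r], i)`, where `Δⁱ(S) = ∂^[i] S` is the
`i`-th iterated shadow and `A ∨ B = {a ∪ b : a ∈ A, b ∈ B}` is written `A ⊻ B`. -/
def extensionFamily (n k r : ℕ) (S : Finset (Finset ℕ)) : Finset (Finset ℕ) :=
  (range (k + 1)).biUnion fun i => (∂^[i] S) ⊻ powersetCard i (Icc (n + 1) (n + r))

/-!
# Extension families are extremal for the Kruskal–Katona theorem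

Let `F` be the extension of the family `S` of `k`-sets by `r` new points. Its `i`-th shadow consists
of the `(k - i)`-sets whose old part lies in a member of `S`. Counting by the number of new points
gives `|∂^(k-p) F| = f p r` with `f p r = ∑ j, |∂^(k-p+j) S| * C(r, j)`
(`shadow_iterate_jointFamily`, `card_jointFamily`). Since the forward difference of `C(r, j)` is
`C(r, j - 1)`, the forward difference of `f (p + 1)` is `f p`, while `f 0 = 1`. Summing up, there are
numbers `c₀, c₁, …`, independent of `p`, such that for `r = R + x` with a suitable `R`
`f p r = 1 + C(c₀ + x, p) + C(c₁ + x, p - 1) + ⋯ + C(cₚ₋₁ + x, 1)` (`exists_eq_sum_choose`).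

Nothing so far says that `c` is decreasing. Let `a₀ > ⋯ > aₖ₋₁` be the cascade of `|F| - 1`, so that
`{a₀, …, aₖ₋₁}` is the last set of the colex initial segment of size `|F|`. The iterated
Kruskal–Katona theorem, applied to all iterated shadows of `F` at once
(`sum_choose_lt_card_shadow_iterate`), bounds every cascade of `a` of length `p` by the
corresponding cascade of `c + x`, with equality for `p = k`. This forces `aⱼ = cⱼ + x` for all `j`
(`eq_of_sum_choose_le`), so equality holds for all `p`, in particular for `p = k - 1`, the shadow
of `F`. Rewriting `1 + C(a₀, k) + ⋯ + C(aₖ₋₁, 1)` as a binomial decomposition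
(`exists_isBinomialDecomposition`) gives extremality.
-/

/-! ### Cascades of binomial coefficients -/

lemma strictAntiOn_natCases {k x : ℕ} {a : ℕ → ℕ} (ha : StrictAntiOn a (Set.Iio k))
    (hx : ∀ j < k, a j < x) :
    StrictAntiOn (fun j => Nat.casesOn j x a : ℕ → ℕ) (Set.Iio (k + 1)) := by
  intro i hi j hj hij
  rcases j with _ | j
  · omega
  have hj' : j < k := by simpa using hj
  rcases i with _ | i
  · exact hx j hj'
  · exact ha (show i < k by omega) hj' (by omega)

lemma StrictAntiOn.comp_succ {β : Type*} [Preorder β] {k : ℕ} {a : ℕ → β}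
    (ha : StrictAntiOn a (Set.Iio (k + 1))) :
    StrictAntiOn (fun j => a (j + 1)) (Set.Iio k) := fun i hi j hj hij =>
  ha (show i + 1 < k + 1 by simpa using hi) (show j + 1 < k + 1 by simpa using hj) (by omega)

lemma StrictAntiOn.succ_lt_zero {β : Type*} [Preorder β] {k : ℕ} {a : ℕ → β}
    (ha : StrictAntiOn a (Set.Iio (k + 1))) : ∀ j < k, a (j + 1) < a 0 := fun j hj =>
  ha (show 0 < k + 1 by omega) (show j + 1 < k + 1 by omega) (by omega)

lemma sum_choose_lt_choose (k : ℕ) : ∀ {a : ℕ → ℕ} {x : ℕ}, StrictAntiOn a (Set.Iio k) →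
    (∀ j < k, a j < x) → ∑ j ∈ range k, (a j).choose (k - j) < x.choose k := by
  induction k with
  | zero => intro a x _ _; simp
  | succ k ih =>
    intro a x ha hx
    have h := ih ha.comp_succ ha.succ_lt_zero
    have h2 : (a 0 + 1).choose (k + 1) ≤ x.choose (k + 1) := Nat.choose_le_choose _ (hx 0 (by omega))
    rw [Nat.choose_succ_succ'] at h2
    rw [sum_range_succ']
    simp only [Nat.add_sub_add_right, Nat.sub_zero]
    omega

/-- Every natural number is a sum of exactly `k + 1` terms `C(a₀, k + 1) + ⋯ + C(aₖ, 1)` with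
`a₀ > ⋯ > aₖ`. The terms at the end are allowed to vanish, which happens when `aⱼ < k + 1 - j`. -/
lemma exists_cascade (k m : ℕ) : ∃ a : ℕ → ℕ, StrictAntiOn a (Set.Iio (k + 1)) ∧
    m = ∑ j ∈ range (k + 1), (a j).choose (k + 1 - j) := by
  induction k generalizing m with
  | zero =>
    refine ⟨fun _ => m, ?_, by simp⟩
    intro i hi j hj hij
    simp only [Set.mem_Iio] at hi hj
    omega
  | succ k ih =>
    have hex : ∃ x, m < (x + 1).choose (k + 1 + 1) := by
      refine ⟨m + k + 1, ?_⟩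
      induction m with
      | zero => simp
      | succ m ihm =>
        have h1 : 0 < (m + k + 2).choose (k + 1) := Nat.choose_pos (by omega)
        have h2 := Nat.choose_succ_succ' (m + k + 2) (k + 1)
        rw [show m + 1 + k + 1 + 1 = m + k + 2 + 1 by ring, h2]
        simp only [add_assoc, Nat.reduceAdd] at h1 ihm ⊢
        omega
    classical
    -- The leading term is chosen greedily.
    set x := Nat.find hex with hxdef
    have hx : m < (x + 1).choose (k + 1 + 1) := Nat.find_spec hex
    have hx' : x.choose (k + 1 + 1) ≤ m := by
      rcases hx0 : x with _ | y
      · simp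
      · exact not_lt.1 (Nat.find_min hex (m := y) (by omega))
    obtain ⟨a, ha, hsum⟩ := ih (m - x.choose (k + 1 + 1))
    have h0 : a 0 < x := by
      by_contra hcon
      have h1 : x.choose (k + 1) ≤ (a 0).choose (k + 1) := Nat.choose_le_choose _ (not_lt.1 hcon)
      have h2 : (a 0).choose (k + 1) ≤ m - x.choose (k + 1 + 1) := by
        rw [hsum, sum_range_succ']
        simp
      rw [Nat.choose_succ_succ'] at hx
      omega
    refine ⟨fun j => Nat.casesOn j x a, strictAntiOn_natCases ha ?_, ?_⟩
    · rintro (_ | j) hj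
      · exact h0
      · exact (ha.succ_lt_zero j (by omega)).trans h0
    · rw [sum_range_succ']
      simp only [Nat.add_sub_add_right, Nat.sub_zero]
      rw [← hsum]
      exact (Nat.sub_add_cancel hx').symm

/-- A cascade with strictly decreasing `a` and the same value as the cascade of an arbitrary
sequence `c` agrees with it as soon as all shorter cascades are bounded by those of `c`: at the
first index `j` of difference the bound for length `j + 1` forces `a j < c j`, and then
`sum_choose_lt_choose` makes the remaining terms of `a` too small. -/
lemma eq_of_sum_choose_le {k : ℕ} {a c : ℕ → ℕ} (ha : StrictAntiOn a (Set.Iio k))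
    (hle : ∀ p ≤ k, ∑ j ∈ range p, (a j).choose (p - j) ≤ ∑ j ∈ range p, (c j).choose (p - j))
    (heq : ∑ j ∈ range k, (a j).choose (k - j) = ∑ j ∈ range k, (c j).choose (k - j)) :
    ∀ j < k, a j = c j := by
  intro j
  induction j using Nat.strong_induction_on with
  | _ j ih =>
    intro hj
    have hpre : ∀ p, ∑ i ∈ range j, (a i).choose (p - i) = ∑ i ∈ range j, (c i).choose (p - i) :=
      fun p => sum_congr rfl fun i hi => by
        rw [ih i (mem_range.1 hi) ((mem_range.1 hi).trans hj)]
    have h1 := hle (j + 1) hj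
    rw [sum_range_succ, sum_range_succ, hpre] at h1
    simp only [Nat.add_sub_cancel_left, Nat.choose_one_right, add_le_add_iff_left] at h1
    by_contra hne
    obtain ⟨l, rfl⟩ := Nat.exists_eq_add_of_le hj.le
    have h2 : ∑ i ∈ range l, (a (j + i)).choose (l - i) < (a j + 1).choose l := by
      refine sum_choose_lt_choose l (fun i hi i' hi' h => ?_) fun i hi => ?_
      · simp only [Set.mem_Iio] at hi hi'
        exact ha (show j + i < j + l by omega) (show j + i' < j + l by omega) (by omega)
      · exact Nat.lt_succ_of_le (ha.antitoneOn (show j < j + l by omega)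
          (show j + i < j + l by omega) (by omega))
    have h3 : (a j + 1).choose l ≤ (c j).choose l := Nat.choose_le_choose _ (by omega)
    have h4 : (c j).choose l ≤ ∑ i ∈ range l, (c (j + i)).choose (l - i) := by
      obtain ⟨l, rfl⟩ : ∃ l', l = l' + 1 := ⟨l - 1, by omega⟩
      rw [sum_range_succ']
      simp
    rw [sum_range_add, sum_range_add, hpre] at heq
    simp only [Nat.add_sub_add_left] at heq
    omega

/-- If `m` is a full-length cascade of `a`, the number `m + 1` has a binomial decomposition for which
the expected shadow size is `C(a₀, k) + ⋯ + C(aₖ, 0)`. It arises from the cascade by adding the `1`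
to the last term and merging with Pascal's rule as long as two consecutive upper entries agree. The
last two conditions are what the induction needs: only a decomposition with a single term can have
a carry that reaches the previous term. -/
lemma exists_isBinomialDecomposition (k : ℕ) : ∀ {a : ℕ → ℕ}, StrictAntiOn a (Set.Iio (k + 1)) →
    ∃ t b, IsBinomialDecomposition (k + 1)
        (∑ j ∈ range (k + 1), (a j).choose (k + 1 - j) + 1) t b ∧
      ∑ j ∈ range (k + 1), (a j).choose (k - j) = ∑ j ∈ range (t + 1), (b j).choose (k - j) ∧
      b 0 ≤ a 0 + 1 ∧ (b 0 = a 0 + 1 → t = 0) := by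
  induction k with
  | zero =>
    intro a _
    refine ⟨0, fun _ => a 0 + 1, ⟨by simp, by simp, by simp, by simp⟩, by simp, by simp, by simp⟩
  | succ k ih =>
    intro a ha
    obtain ⟨t, b, hb, hsh, hb0, ht⟩ := ih ha.comp_succ
    have hsum := hb.sum_eq
    have h10 : a 1 < a 0 := ha.succ_lt_zero 0 (by omega)
    simp only [zero_add] at hb0 ht
    by_cases h : b 0 = a 0
    -- The carry reaches `a 0`, and `C(a₀, k + 2) + C(a₀, k + 1) = C(a₀ + 1, k + 2)`.
    · obtain rfl := ht (by omega)
      have hlast := hb.le_last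
      simp only [zero_add, sum_range_one, Nat.sub_zero] at hsum hsh hlast
      refine ⟨0, fun _ => a 0 + 1, ⟨by omega, by simp, by simp; omega, ?_⟩, ?_, by simp, by simp⟩
      · rw [sum_range_succ']
        simp only [zero_add, sum_range_one, Nat.add_sub_add_right, Nat.sub_zero]
        rw [add_right_comm, hsum, h, Nat.choose_succ_succ' (a 0) (k + 1)]
      · rw [sum_range_succ']
        simp only [zero_add, sum_range_one, Nat.add_sub_add_right, Nat.sub_zero]
        rw [hsh, h, Nat.choose_succ_succ' (a 0) k]
    · refine ⟨t + 1, fun j => Nat.casesOn j (a 0) b, ⟨?_, ?_, ?_, ?_⟩, ?_, by simp, by simp⟩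
      · have := hb.length_le
        omega
      · rintro (_ | i) hi
        · show b 0 < a 0
          omega
        · exact hb.strictAnti i (by omega)
      · have := hb.le_last
        simpa using this
      · rw [sum_range_succ', sum_range_succ' _ (t + 1)]
        simp only [Nat.add_sub_add_right, Nat.sub_zero]
        rw [add_right_comm, hsum]
        rfl
      · rw [sum_range_succ', sum_range_succ' _ (t + 1)]
        simp only [Nat.add_sub_add_right, Nat.sub_zero]
        rw [hsh]
        rfl

/-- Functions with `f 0 = 1` whose differences satisfy `Δ f (p + 1) = f p` are, from some point `R` on,
given by cascades with the same shifts `c` for all `p ≤ k`. The difference of `f (k + 1)` and the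
sum of the terms that lift those of `f k` has difference `1`, so it is linear with slope `1` and
supplies the last term. -/
lemma exists_eq_sum_choose (f : ℕ → ℕ → ℕ) (h0 : ∀ r, f 0 r = 1)
    (hsucc : ∀ p r, f (p + 1) (r + 1) = f (p + 1) r + f p r) (k : ℕ) :
    ∃ (R : ℕ) (c : ℕ → ℕ), ∀ p ≤ k, ∀ x,
      f p (R + x) = ∑ j ∈ range p, (c j + x).choose (p - j) + 1 := by
  induction k with
  | zero =>
    refine ⟨0, 0, fun p hp x => ?_⟩
    obtain rfl := Nat.le_zero.1 hp
    simp [h0]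
  | succ k ih =>
    obtain ⟨R, c, h⟩ := ih
    set d := ∑ j ∈ range k, (c j).choose (k + 1 - j)
    have key : ∀ x, f (k + 1) (R + x) + d =
        ∑ j ∈ range k, (c j + x).choose (k + 1 - j) + x + f (k + 1) R := by
      intro x
      induction x with
      | zero => simp [d, add_comm]
      | succ x ihx =>
        have hP : ∑ j ∈ range k, (c j + (x + 1)).choose (k + 1 - j) =
            ∑ j ∈ range k, (c j + x).choose (k - j) +
              ∑ j ∈ range k, (c j + x).choose (k + 1 - j) := by
          rw [← sum_add_distrib]
          refine sum_congr rfl fun j hj => ?_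
          rw [Nat.succ_sub (mem_range.1 hj).le, ← add_assoc, Nat.choose_succ_succ']
        rw [← add_assoc, hsucc, h k le_rfl, hP]
        omega
    -- Shifting by `d + 1` makes the new entry `f (k + 1) (R + (d + 1)) - ∑ … - 1`, which is
    -- `f (k + 1) R` by `key`, a natural number.
    refine ⟨R + (d + 1), fun j => if j < k then c j + (d + 1) else f (k + 1) R, ?_⟩
    intro p hp x
    have hc : ∀ q, ∑ j ∈ range k, ((if j < k then c j + (d + 1) else f (k + 1) R) + x).choose (q - j)
        = ∑ j ∈ range k, (c j + (d + 1 + x)).choose (q - j) := fun q =>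
      sum_congr rfl fun j hj => by rw [if_pos (mem_range.1 hj), add_assoc]
    rcases hp.lt_or_eq with hp | rfl
    · rw [add_assoc, h p (by omega)]
      congr 1
      refine sum_congr rfl fun j hj => ?_
      simp only [if_pos (show j < k by have := mem_range.1 hj; omega), add_assoc]
    · have := key (d + 1 + x)
      rw [sum_range_succ, hc, add_assoc R]
      simp only [lt_irrefl, if_false, Nat.add_sub_cancel_left, Nat.choose_one_right]
      omega

/-! ### The Kruskal–Katona theorem for numbers -/

/-- The elements of `{a₀ > ⋯ > aₖ₋₁}` determine its position in colex: the sets below it either have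
all their elements below `a₀`, or contain `a₀` and are below it after deleting `a₀`. -/
lemma card_initSeg_image {N : ℕ} (k : ℕ) : ∀ {a : ℕ → Fin N}, StrictAntiOn a (Set.Iio k) →
    #(Colex.initSeg ((range k).image a)) = ∑ j ∈ range k, (a j : ℕ).choose (k - j) + 1 := by
  induction k with
  | zero =>
    intro a _
    have : Colex.initSeg (∅ : Finset (Fin N)) = {∅} := by
      ext t
      simp only [Colex.mem_initSeg, card_empty, mem_singleton]
      constructor
      · rintro ⟨h, -⟩
        exact card_eq_zero.1 h.symm
      · rintro rfl
        simp
    simp [this]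
  | succ k ih =>
    intro a ha
    have hins : (range (k + 1)).image a = insert (a 0) ((range k).image fun j => a (j + 1)) := by
      rw [range_add_one']
      simp [image_image, Function.comp_def, map_eq_image]
      rfl
    have hcard : #((range (k + 1)).image a) = k + 1 := by
      rw [card_image_of_injOn, card_range]
      simpa using ha.injOn
    set s := (range k).image fun j => a (j + 1) with hs
    have hcards : #s = k := by
      rw [card_image_of_injOn, card_range]
      simpa using ha.comp_succ.injOn
    have hlt : ∀ y ∈ s, y < a 0 := by
      simp only [hs, mem_image, mem_range, forall_exists_index, and_imp]
      rintro _ j hj rfl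
      exact ha.succ_lt_zero j hj
    have h0s : a 0 ∉ s := fun h => (hlt _ h).false
    have hseg : Colex.initSeg ((range (k + 1)).image a) =
        powersetCard (k + 1) (Iio (a 0)) ∪ (Colex.initSeg s).image (insert (a 0)) := by
      ext t
      simp only [Colex.mem_initSeg, hcard, mem_union, mem_powersetCard, mem_image, hcards]
      rw [hins]
      constructor
      · rintro ⟨ht, hle⟩
        have hb : ∀ y ∈ t, y ≤ a 0 := Colex.forall_le_mono hle (by
          simp only [mem_insert, forall_eq_or_imp, le_refl, true_and]
          exact fun y hy => (hlt y hy).le)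
        by_cases h0 : a 0 ∈ t
        · refine Or.inr ⟨t.erase (a 0), ⟨?_, ?_⟩, insert_erase h0⟩
          · rw [card_erase_of_mem h0]; omega
          · rwa [← Colex.toColex_sdiff_le_toColex_sdiff (singleton_subset_iff.2 h0)
              (singleton_subset_iff.2 (mem_insert_self _ _)), sdiff_singleton_eq_erase,
              sdiff_singleton_eq_erase, erase_insert h0s] at hle
        · refine Or.inl ⟨fun y hy => mem_Iio.2 (lt_of_le_of_ne (hb y hy) ?_), ht.symm⟩
          rintro rfl
          exact h0 hy
      · rintro (⟨hsub, ht⟩ | ⟨u, ⟨hu, hle⟩, rfl⟩)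
        · refine ⟨ht.symm, le_of_lt ?_⟩
          refine lt_of_lt_of_le (Colex.toColex_lt_singleton.2 fun y hy => mem_Iio.1 (hsub hy)) ?_
          exact Colex.toColex_le_toColex_of_subset (by simp)
        · have h0u : a 0 ∉ u := fun h => (Colex.forall_lt_mono hle hlt _ h).false
          refine ⟨by rw [card_insert_of_notMem h0u, hu], ?_⟩
          rwa [← Colex.toColex_sdiff_le_toColex_sdiff (singleton_subset_iff.2 (mem_insert_self _ _))
            (singleton_subset_iff.2 (mem_insert_self _ _)), sdiff_singleton_eq_erase,
            sdiff_singleton_eq_erase, erase_insert h0u, erase_insert h0s]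
    rw [hseg, card_union_of_disjoint, card_powersetCard, card_image_of_injOn, ih ha.comp_succ,
      sum_range_succ', Fin.card_Iio]
    · simp only [Nat.add_sub_add_right, Nat.sub_zero]
      omega
    · intro u hu v hv huv
      have h0 : ∀ u ∈ Colex.initSeg s, a 0 ∉ u := fun u hu h =>
        (Colex.forall_lt_mono (Colex.mem_initSeg.1 hu).2 hlt _ h).false
      have := congrArg (fun w => w.erase (a 0)) huv
      simpa [erase_insert (h0 u hu), erase_insert (h0 v hv)] using this
    · rw [disjoint_left]
      intro t ht ht'
      obtain ⟨u, -, rfl⟩ := mem_image.1 ht'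
      have := (mem_powersetCard.1 ht).1 (mem_insert_self _ _)
      simp at this

lemma shadow_initSeg_image {N k : ℕ} {a : ℕ → Fin N} (ha : StrictAntiOn a (Set.Iio (k + 1))) :
    ∂ (Colex.initSeg ((range (k + 1)).image a)) = Colex.initSeg ((range k).image a) := by
  have hne : ((range (k + 1)).image a).Nonempty := by simp
  rw [Colex.shadow_initSeg hne]
  congr 1
  have hmin : ((range (k + 1)).image a).min' hne = a k := by
    refine le_antisymm (min'_le _ _ (mem_image_of_mem _ (by simp))) (le_min' _ _ _ ?_)
    simp only [mem_image, mem_range, forall_exists_index, and_imp]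
    rintro _ j hj rfl
    exact ha.antitoneOn (show j < k + 1 from hj) (show k < k + 1 by omega) (by omega)
  rw [hmin, range_add_one, image_insert, erase_insert]
  simp only [mem_image, mem_range, not_exists, not_and]
  intro j hj h
  exact absurd (ha (show j < k + 1 by omega) (show k < k + 1 by omega) hj) (by simp [h])

lemma shadow_iterate_initSeg_image {N i k : ℕ} : ∀ {a : ℕ → Fin N},
    StrictAntiOn a (Set.Iio (k + i)) →
    ∂^[i] (Colex.initSeg ((range (k + i)).image a)) = Colex.initSeg ((range k).image a) := by
  induction i with
  | zero => simp
  | succ i ih =>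
    intro a ha
    rw [Function.iterate_succ_apply, ← add_assoc, shadow_initSeg_image (k := k + i) ha]
    exact ih (ha.mono (Set.Iio_subset_Iio (by omega)))

/-- The iterated Kruskal–Katona theorem in terms of cascades: a family with more than
`C(a₀, l) + ⋯ + C(aₗ₋₁, 1)` sets of size `l` is at least as large as the colex initial segment
ending at `{a₀, …, aₗ₋₁}`, and the `i`-th shadow of that segment is the one ending at the set of the
`l - i` largest of these numbers. -/
lemma sum_choose_lt_card_shadow_iterate {i k l : ℕ} {a : ℕ → ℕ} {F : Finset (Finset ℕ)}
    (hl : l = k + i) (ha : StrictAntiOn a (Set.Iio l)) (hF : (F : Set (Finset ℕ)).Sized l)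
    (hcard : ∑ j ∈ range l, (a j).choose (l - j) < #F) :
    ∑ j ∈ range k, (a j).choose (k - j) < #(∂^[i] F) := by
  classical
  subst hl
  -- All the sets and numbers involved live in `Fin N`.
  obtain ⟨N, hNa, hNF⟩ : ∃ N, (∀ j < k + i, a j < N + 1) ∧ ∀ s ∈ F, ∀ x ∈ s, x < N + 1 := by
    refine ⟨∑ j ∈ range (k + i), a j + ∑ s ∈ F, ∑ x ∈ s, x, fun j hj => ?_, fun s hs x hx => ?_⟩
    · have := single_le_sum (f := a) (fun _ _ => Nat.zero_le _) (mem_range.2 hj)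
      omega
    · have h1 := single_le_sum (f := fun x : ℕ => x) (fun _ _ => Nat.zero_le _) hx
      have h2 := single_le_sum (f := fun s : Finset ℕ => ∑ x ∈ s, x) (fun _ _ => Nat.zero_le _) hs
      omega
  let φ : Finset (Fin (N + 1)) ↪ Finset ℕ := (mapEmbedding Fin.valEmbedding).toEmbedding
  have hφ : ∀ s, φ s = s.map Fin.valEmbedding := fun _ => rfl
  let G : Finset (Finset (Fin (N + 1))) := univ.filter fun s => φ s ∈ F
  have hFG : #F ≤ #G := by
    rw [← card_map φ]
    refine card_le_card fun s hs => mem_map.2 ⟨s.attachFin (hNF s hs), ?_, ?_⟩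
    · simp only [G, mem_filter, mem_univ, true_and, hφ]
      rwa [map_valEmbedding_attachFin]
    · rw [hφ, map_valEmbedding_attachFin]
  have hGF : #(∂^[i] G) ≤ #(∂^[i] F) := by
    rw [← card_map φ]
    refine card_le_card fun s hs => ?_
    obtain ⟨t, ht, rfl⟩ := mem_map.1 hs
    obtain ⟨u, hu, htu, huc⟩ := mem_shadow_iterate_iff_exists_mem_card_add.1 ht
    refine mem_shadow_iterate_iff_exists_mem_card_add.2 ⟨φ u, (mem_filter.1 hu).2, ?_, ?_⟩
    · exact map_subset_map.2 htu
    · simpa [hφ] using huc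
  have hG : (G : Set (Finset (Fin (N + 1)))).Sized (k + i) := by
    intro s hs
    have : φ s ∈ F := by simpa [G] using hs
    simpa [hφ] using hF this
  let b : ℕ → Fin (N + 1) := fun j => Fin.ofNat (N + 1) (a j)
  have hb : ∀ j < k + i, (b j : ℕ) = a j := fun j hj => Nat.mod_eq_of_lt (hNa j hj)
  have hbanti : StrictAntiOn b (Set.Iio (k + i)) := fun j hj l hl hjl => by
    rw [Fin.lt_def, hb j hj, hb l hl]
    exact ha hj hl hjl
  have hsum : ∀ p ≤ k + i, ∀ q, ∑ j ∈ range p, (b j : ℕ).choose (q - j) =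
      ∑ j ∈ range p, (a j).choose (q - j) := fun p hp q => sum_congr rfl fun j hj => by
    rw [hb j ((mem_range.1 hj).trans_le hp)]
  have hsize : #((range (k + i)).image b) = k + i := by
    rw [card_image_of_injOn, card_range]
    simpa using hbanti.injOn
  have hseg := Colex.isInitSeg_initSeg (s := (range (k + i)).image b)
  rw [hsize] at hseg
  have h1 : #(Colex.initSeg ((range (k + i)).image b)) ≤ #G := by
    rw [card_initSeg_image _ hbanti, hsum _ le_rfl]
    omega
  have h2 := iterated_kk (k := i) hG h1 hseg
  rw [shadow_iterate_initSeg_image hbanti,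
    card_initSeg_image k (hbanti.mono (Set.Iio_subset_Iio (by omega))), hsum _ (by omega)] at h2
  omega

/-! ### The extension family and its shadows -/

/-- The `p`-sets whose part outside `Y` is a subset of a member of `S`, for a family `S` of `k`-sets
disjoint from `Y` and `p ≤ k` (see `mem_jointFamily`). It is written as a union over the size `j` of
the part in `Y`, as in `extensionFamily`, which is the case `p = k`. -/
def jointFamily (k p : ℕ) (S : Finset (Finset ℕ)) (Y : Finset ℕ) : Finset (Finset ℕ) :=
  (range (p + 1)).biUnion fun j => (∂^[k - (p - j)] S) ⊻ powersetCard j Y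

lemma extensionFamily_eq (n k r : ℕ) (S : Finset (Finset ℕ)) :
    extensionFamily n k r S = jointFamily k k S (Icc (n + 1) (n + r)) := by
  refine biUnion_congr rfl fun j hj => ?_
  rw [Nat.sub_sub_self (Nat.lt_succ_iff.1 (mem_range.1 hj))]

section

variable {k : ℕ} {S : Finset (Finset ℕ)} {X Y : Finset ℕ}

lemma subset_of_mem_shadow_iterate {i : ℕ} (hS : S ⊆ powersetCard k X) {c : Finset ℕ}
    (hc : c ∈ ∂^[i] S) : c ⊆ X := by
  obtain ⟨s, hs, hcs, -⟩ := mem_shadow_iterate_iff_exists_mem_card_add.1 hc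
  exact hcs.trans (mem_powersetCard.1 (hS hs)).1

lemma union_inter_left_of_disjoint {c d : Finset ℕ} (hXY : Disjoint X Y) (hc : c ⊆ X) (hd : d ⊆ Y) :
    (c ∪ d) ∩ X = c := by
  rw [union_inter_distrib_right, inter_eq_left.2 hc,
    disjoint_iff_inter_eq_empty.1 (hXY.symm.mono_left hd), union_empty]

lemma mem_jointFamily (hS : S ⊆ powersetCard k X) (hXY : Disjoint X Y) {p : ℕ} (hp : p ≤ k)
    {C : Finset ℕ} :
    C ∈ jointFamily k p S Y ↔ C ⊆ X ∪ Y ∧ #C = p ∧ ∃ s ∈ S, C ∩ X ⊆ s := by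
  simp only [jointFamily, mem_biUnion, mem_range, mem_sups, mem_powersetCard, sup_eq_union]
  constructor
  · rintro ⟨j, hj, c, hc, d, ⟨hd, rfl⟩, rfl⟩
    have hcX := subset_of_mem_shadow_iterate hS hc
    obtain ⟨s, hs, hcs, hcard⟩ := mem_shadow_iterate_iff_exists_mem_card_add.1 hc
    rw [(mem_powersetCard.1 (hS hs)).2] at hcard
    refine ⟨union_subset_union hcX hd, ?_, s, hs, ?_⟩
    · rw [card_union_of_disjoint (hXY.mono hcX hd)]
      omega
    · rwa [union_inter_left_of_disjoint hXY hcX hd]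
  · rintro ⟨hC, rfl, s, hs, hCs⟩
    have hCe : C ∩ X ∪ C ∩ Y = C := by rw [← inter_union_distrib_left, inter_eq_left.2 hC]
    have hcard : #(C ∩ X) + #(C ∩ Y) = #C := by
      rw [← card_union_of_disjoint (hXY.mono inter_subset_right inter_subset_right), hCe]
    refine ⟨#(C ∩ Y), by omega, C ∩ X, ?_, C ∩ Y, ⟨inter_subset_right, rfl⟩, hCe⟩
    refine mem_shadow_iterate_iff_exists_mem_card_add.2 ⟨s, hs, hCs, ?_⟩
    rw [(mem_powersetCard.1 (hS hs)).2]
    omega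

/-- A member of `jointFamily k p S Y` with trace contained in `s ∈ S` extends to a `k`-set by adding
elements of `s` only. -/
lemma shadow_iterate_jointFamily (hS : S ⊆ powersetCard k X) (hXY : Disjoint X Y) {p i : ℕ}
    (hpi : p + i = k) : ∂^[i] (jointFamily k k S Y) = jointFamily k p S Y := by
  ext C
  rw [mem_shadow_iterate_iff_exists_mem_card_add, mem_jointFamily hS hXY (by omega)]
  constructor
  · rintro ⟨A, hA, hCA, hcard⟩
    obtain ⟨hAXY, hAk, s, hs, hAs⟩ := (mem_jointFamily hS hXY le_rfl).1 hA
    exact ⟨hCA.trans hAXY, by omega, s, hs, (inter_subset_inter_right hCA).trans hAs⟩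
  · rintro ⟨hC, hCp, s, hs, hCs⟩
    obtain ⟨hsX, hsk⟩ := mem_powersetCard.1 (hS hs)
    obtain ⟨A, hCA, hAs, hAk⟩ := exists_subsuperset_card_eq (n := k)
      (subset_union_left : C ⊆ C ∪ s) (by omega)
      (hsk.symm.le.trans (card_le_card subset_union_right))
    refine ⟨A, (mem_jointFamily hS hXY le_rfl).2 ⟨?_, hAk, s, hs, ?_⟩, hCA, by omega⟩
    · exact hAs.trans (union_subset hC (hsX.trans subset_union_left))
    · refine (inter_subset_inter_right hAs).trans ?_
      rw [union_inter_distrib_right]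
      exact union_subset hCs inter_subset_left

lemma card_jointFamily (hS : S ⊆ powersetCard k X) (hXY : Disjoint X Y) (p : ℕ) :
    #(jointFamily k p S Y) = ∑ j ∈ range (p + 1), #(∂^[k - (p - j)] S) * (#Y).choose j := by
  have hY : ∀ {i j : ℕ} {c d : Finset ℕ}, c ∈ ∂^[i] S → d ∈ powersetCard j Y →
      (c ∪ d) ∩ X = c ∧ (c ∪ d) ∩ Y = d := fun hc hd => by
    have hcX := subset_of_mem_shadow_iterate hS hc
    have hdY := (mem_powersetCard.1 hd).1
    refine ⟨union_inter_left_of_disjoint hXY hcX hdY, ?_⟩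
    rw [union_comm]
    exact union_inter_left_of_disjoint hXY.symm hdY hcX
  rw [jointFamily, card_biUnion]
  · refine sum_congr rfl fun j _ => ?_
    rw [(card_sups_iff _ _).2, card_powersetCard]
    rintro ⟨c, d⟩ hcd ⟨c', d'⟩ hcd' h
    simp only [Set.mem_prod, mem_coe] at hcd hcd'
    simp only [sup_eq_union] at h
    have h1 := hY hcd.1 hcd.2
    have h2 := hY hcd'.1 hcd'.2
    rw [h] at h1
    exact Prod.ext (h1.1.symm.trans h2.1) (h1.2.symm.trans h2.2)
  · intro i _ j _ hij
    rw [Function.onFun, disjoint_left]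
    intro A hA hA'
    obtain ⟨c, hc, d, hd, rfl⟩ := mem_sups.1 hA
    obtain ⟨c', hc', d', hd', h⟩ := mem_sups.1 hA'
    simp only [sup_eq_union] at h
    have h1 := hY hc hd
    have h2 := hY hc' hd'
    rw [h] at h2
    apply hij
    rw [← (mem_powersetCard.1 hd).2, ← (mem_powersetCard.1 hd').2, ← h1.2, h2.2]

end

/-- The forward difference takes `C(r, j)` to `C(r, j - 1)`. -/
lemma sum_mul_choose_succ (t : ℕ → ℕ) (p r : ℕ) :
    ∑ j ∈ range (p + 2), t (p + 1 - j) * (r + 1).choose j =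
      ∑ j ∈ range (p + 2), t (p + 1 - j) * r.choose j +
        ∑ j ∈ range (p + 1), t (p - j) * r.choose j := by
  rw [sum_range_succ', sum_range_succ' _ (p + 1)]
  simp only [Nat.choose_succ_succ', mul_add, sum_add_distrib, Nat.add_sub_add_right,
    Nat.choose_zero_right]
  omega

/-! ### Extremality -/

theorem theorem9 (n k : ℕ) (hk : 1 ≤ k) (S : Finset (Finset ℕ))
    (hS : S ⊆ powersetCard k (Icc 1 n)) (hne : S.Nonempty) :
    ∃ r₀ : ℕ, 0 < r₀ ∧ ∀ r : ℕ, r₀ ≤ r →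
      IsExtremalFamily (n + r) k (extensionFamily n k r S) ∧
      (extensionFamily n k r S).filter (fun A => A ⊆ Icc 1 n) = S := by
  obtain ⟨k, rfl⟩ : ∃ l, k = l + 1 := ⟨k - 1, by omega⟩
  have hdisj : ∀ r, Disjoint (Icc 1 n) (Icc (n + 1) (n + r)) := fun r => by
    rw [disjoint_left]
    intro x hx hx'
    simp only [mem_Icc] at hx hx'
    omega
  have hunion : ∀ r, Icc 1 n ∪ Icc (n + 1) (n + r) = Icc 1 (n + r) := fun r => by
    ext x
    simp only [mem_union, mem_Icc]
    omega
  set f : ℕ → ℕ → ℕ := fun p r =>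
    ∑ j ∈ range (p + 1), #(∂^[k + 1 - (p - j)] S) * r.choose j with hf
  have hcard : ∀ p r, #(jointFamily (k + 1) p S (Icc (n + 1) (n + r))) = f p r := fun p r => by
    rw [card_jointFamily hS (hdisj r)]
    simp [hf]
  have htop : ∂^[k + 1] S = {∅} := by
    ext C
    rw [mem_shadow_iterate_iff_exists_mem_card_add, mem_singleton]
    constructor
    · rintro ⟨s, hs, -, hc⟩
      rw [(mem_powersetCard.1 (hS hs)).2] at hc
      exact card_eq_zero.1 (by omega)
    · rintro rfl
      obtain ⟨s, hs⟩ := hne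
      exact ⟨s, hs, empty_subset _, by simp [(mem_powersetCard.1 (hS hs)).2]⟩
  obtain ⟨R, c, hc⟩ := exists_eq_sum_choose f (fun r => by simp [hf, htop])
    (fun p r => sum_mul_choose_succ (fun q => #(∂^[k + 1 - q] S)) p r) (k + 1)
  refine ⟨R + 1, by omega, fun r hr => ?_⟩
  obtain ⟨x, rfl⟩ := Nat.exists_eq_add_of_le (show R ≤ r by omega)
  rw [extensionFamily_eq]
  set Y := Icc (n + 1) (n + (R + x)) with hY
  have hXY : Disjoint (Icc 1 n) Y := hdisj _
  have hmem := fun C => mem_jointFamily (C := C) hS hXY le_rfl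
  have hsub : S ⊆ jointFamily (k + 1) (k + 1) S Y := fun s hs => by
    obtain ⟨hsX, hsk⟩ := mem_powersetCard.1 (hS hs)
    exact (hmem s).2 ⟨hsX.trans subset_union_left, hsk, s, hs, inter_subset_left⟩
  obtain ⟨a, ha, hsum⟩ := exists_cascade k (∑ j ∈ range (k + 1), (c j + x).choose (k + 1 - j))
  have hac : ∀ j < k + 1, a j = c j + x := by
    refine eq_of_sum_choose_le ha (fun p hp => ?_) hsum.symm
    obtain ⟨i, hi⟩ := Nat.exists_eq_add_of_le hp
    have hsized : (jointFamily (k + 1) (k + 1) S Y : Set (Finset ℕ)).Sized (k + 1) :=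
      fun A hA => ((hmem A).1 hA).2.1
    have hlt : ∑ j ∈ range (k + 1), (a j).choose (k + 1 - j) <
        #(jointFamily (k + 1) (k + 1) S Y) := by
      rw [hcard, hc _ le_rfl, ← hsum]
      omega
    have := sum_choose_lt_card_shadow_iterate hi ha hsized hlt
    rw [shadow_iterate_jointFamily hS hXY hi.symm, hcard, hc p hp] at this
    omega
  have hac' : ∀ q, ∑ j ∈ range (k + 1), (c j + x).choose (q - j) =
      ∑ j ∈ range (k + 1), (a j).choose (q - j) := fun q =>
    sum_congr rfl fun j hj => by rw [hac j (mem_range.1 hj)]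
  refine ⟨⟨fun A hA => ?_, hne.mono hsub, ?_⟩, ?_⟩
  · obtain ⟨h1, h2, -⟩ := (hmem A).1 hA
    rw [hunion] at h1
    exact mem_powersetCard.2 ⟨h1, h2⟩
  · obtain ⟨t, b, hb, hsh, -, -⟩ := exists_isBinomialDecomposition k ha
    refine ⟨t, b, ?_, ?_⟩
    · rwa [hcard, hc _ le_rfl, hac']
    · have h1 := shadow_iterate_jointFamily (i := 1) (p := k) hS hXY rfl
      rw [Function.iterate_one] at h1
      rw [h1, hcard, hc k (by omega)]
      simp only [Nat.sub_right_comm _ _ 1, Nat.add_sub_cancel]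
      rw [← hsh, ← hac' k, sum_range_succ]
      simp
  · ext A
    simp only [mem_filter]
    constructor
    · rintro ⟨hA, hAX⟩
      obtain ⟨-, hAk, s, hs, hAs⟩ := (hmem A).1 hA
      rw [inter_eq_left.2 hAX] at hAs
      rwa [eq_of_subset_of_card_le hAs (by rw [(mem_powersetCard.1 (hS hs)).2, hAk])]
    · exact fun hA => ⟨hsub hA, (mem_powersetCard.1 (hS hA)).1⟩
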